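/- All rectangles are nondegenerate, with sides parallel to the coordinate axes. The ratio of a rectangle is the length of its horizontal side divided by the length of its vertical side. A tiling of a rectangle $R$ is a finite set of rectangles with pairwise disjoint interiors whose union is $R$. The algebraic conjugates of an algebraic number are the complex roots of its minimal polynomial over $\mathbb{Q}$. For a real number $c>0$ the following three conditions are equivalent: (1) a rectangle of ratio $c$ can be tiled by rectangles each of which has ratio $c$ or $1/c$, in such a way that at least one rectangle in the tiling has ratio $1/c$; (2) the number $c^2$ is algebraic and all its algebraic conjugates distinct from $c^2$ are negative real numbers; (3) for some $m\ge 1$ and some positive rational numbers $d_1,\dots,d_m$ we have $$\cfrac{1}{d_1 c+\cfrac{1}{d_2 c+\dots+\cfrac{1}{d_m c}}}=c.$$ -/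

import Mathlib

/-- A nondegenerate rectangle in the plane with sides parallel to the coordinate axes,
`[left, right] × [bottom, top]`. -/
structure Rect where
  left : ℝ
  right : ℝ
  bottom : ℝ
  top : ℝ
  left_lt_right : left < right
  bottom_lt_top : bottom < top

/-- The closed region occupied by a rectangle. -/
def Rect.toSet (R : Rect) : Set (ℝ × ℝ) :=
  Set.Icc R.left R.right ×ˢ Set.Icc R.bottom R.top

/-- The ratio of a rectangle: length of the horizontal side over length of the vertical side. -/
noncomputable def Rect.ratio (R : Rect) : ℝ :=
  (R.right - R.left) / (R.top - R.bottom)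

/-- The finite set `T` of rectangles tiles `R`: the tiles cover exactly `R`, and distinct tiles
have disjoint interiors. -/
def IsTiling (T : Finset Rect) (R : Rect) : Prop :=
  (⋃ A ∈ T, A.toSet) = R.toSet ∧
    (T : Set Rect).Pairwise fun A B => Disjoint (interior A.toSet) (interior B.toSet)

/-- The continued fraction `d₁ c + 1 / (d₂ c + ⋯ + 1 / (d_m c))` attached to the list
`[d₁, …, d_m]`; the value at the empty list is a dummy. -/
noncomputable def contFrac (c : ℝ) : List ℚ → ℝ
  | [] => 0
  | [d] => (d : ℝ) * c
  | d :: e :: l => (d : ℝ) * c + 1 / contFrac c (e :: l)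

/-!
# Tilings of a rectangle of ratio `c` by rectangles of ratio `c` and `1 / c`

*From tilings to conjugates.* The area of a rectangle is bilinear in its sides, and finite
subdivision only uses additivity: for arbitrary additive maps `f` and `g` on `ℝ` the quantity
`f (width) * g (height)` is additive under tilings (`IsTiling.sum_mul`). Put `w = c ^ 2`, and
stretch heights by `c`: a square of side `S` is tiled by squares of sides `a` and by rectangles
`b × w b`. A field embedding of `ℚ(w)` in `ℂ` with `w ↦ z` gives additive `f` with
`f (w x) = z f x` and `f b ≠ 0` for a chosen `b` (`exists_additive_semilinear`), hence
`|f S|² = ∑ |f a|² + conj z * ∑ |f b|²`. So `z` is real (`IsMixedTiling.im_eq_zero`). If `z` were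
positive and different from `w`, then, for real `f`, the two mixed areas
`S f S = ∑ a f a + z ∑ b f b = ∑ a f a + w ∑ b f b` would give `S f S = ∑ a f a`, while
`∑ a² ≤ S²` and `∑ (f a)² < (f S)²`, against the Cauchy–Schwarz inequality
(`IsMixedTiling.not_pos`). A transcendental `w` could be sent to `w + 1`, so `w` is algebraic.

*From conjugates to continued fractions.* The minimal polynomial `p` of `w` has a single positive
root and its other roots are negative. If `Q` is a large positive multiple of a monic polynomial
whose roots are negative rationals interlacing those of `p`, then `P = p + Q` and `Q` have
interlacing negative roots. The Euclidean algorithm, dividing alternately by `X * Q` and `Q`,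
preserves interlacing, so all its quotients have positive rational coefficients
(`IsStieltjesPair.exists_contFrac`). It expands `P(c²) / (c Q(c²))`, which is `1 / c` since
`p(c²) = 0`, as a continued fraction.

*From continued fractions to tilings.* Rectangles of ratios `x` and `y` side by side form one of
ratio `x + y`, and reflection in the diagonal turns ratio `x` into `1 / x`. A continued fraction
with positive rational coefficients is built from `c` by these two operations
(`tileable_contFrac`).
-/

/-! ### Additive area functionals and tilings -/

/-- The region `(left, right] × (bottom, top]`. The half-open tiles of a tiling partition the
half-open rectangle exactly. -/
def Rect.halfOpen (R : Rect) : Set (ℝ × ℝ) :=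
  Set.Ioc R.left R.right ×ˢ Set.Ioc R.bottom R.top

theorem Rect.mem_halfOpen {R : Rect} {x y : ℝ} :
    (x, y) ∈ R.halfOpen ↔ (R.left < x ∧ x ≤ R.right) ∧ (R.bottom < y ∧ y ≤ R.top) := by
  simp [Rect.halfOpen]

theorem Rect.mem_toSet {R : Rect} {x y : ℝ} :
    (x, y) ∈ R.toSet ↔ (R.left ≤ x ∧ x ≤ R.right) ∧ (R.bottom ≤ y ∧ y ≤ R.top) := by
  rw [Rect.toSet, Set.mem_prod, Set.mem_Icc, Set.mem_Icc]

theorem Rect.mem_interior {R : Rect} {x y : ℝ} :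
    (x, y) ∈ interior R.toSet ↔
      (R.left < x ∧ x < R.right) ∧ (R.bottom < y ∧ y < R.top) := by
  rw [Rect.toSet, interior_prod_eq, interior_Icc, interior_Icc, Set.mem_prod, Set.mem_Ioo,
    Set.mem_Ioo]

theorem Rect.bounds_of_subset {A R : Rect} (h : A.toSet ⊆ R.toSet) :
    R.left ≤ A.left ∧ A.right ≤ R.right ∧ R.bottom ≤ A.bottom ∧ A.top ≤ R.top := by
  have h1 := Rect.mem_toSet.1 (h (Rect.mem_toSet.2
    ⟨⟨le_refl A.left, A.left_lt_right.le⟩, ⟨le_refl A.bottom, A.bottom_lt_top.le⟩⟩))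
  have h2 := Rect.mem_toSet.1 (h (Rect.mem_toSet.2
    ⟨⟨A.left_lt_right.le, le_refl A.right⟩, ⟨A.bottom_lt_top.le, le_refl A.top⟩⟩))
  exact ⟨h1.1.1, h2.1.2, h1.2.1, h2.2.2⟩

theorem IsTiling.subset {T : Finset Rect} {R A : Rect} (h : IsTiling T R) (hA : A ∈ T) :
    A.toSet ⊆ R.toSet := by
  rw [← h.1]
  exact Set.subset_biUnion_of_mem (u := fun A : Rect => A.toSet) hA

theorem eq_of_mem_halfOpen {T : Finset Rect} {R A B : Rect} (h : IsTiling T R) (hA : A ∈ T)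
    (hB : B ∈ T) {x y : ℝ} (hxA : (x, y) ∈ A.halfOpen) (hxB : (x, y) ∈ B.halfOpen) : A = B := by
  by_contra hne
  have hd := h.2 hA hB hne
  rw [Rect.mem_halfOpen] at hxA hxB
  obtain ⟨u, hu1, hu2⟩ := exists_between (max_lt hxA.1.1 hxB.1.1)
  obtain ⟨v, hv1, hv2⟩ := exists_between (max_lt hxA.2.1 hxB.2.1)
  rw [max_lt_iff] at hu1 hv1
  have hu : (u, v) ∉ interior B.toSet := Set.disjoint_left.1 hd (Rect.mem_interior.2
    ⟨⟨hu1.1, hu2.trans_le hxA.1.2⟩, ⟨hv1.1, hv2.trans_le hxA.2.2⟩⟩)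
  exact hu (Rect.mem_interior.2
    ⟨⟨hu1.2, hu2.trans_le hxB.1.2⟩, ⟨hv1.2, hv2.trans_le hxB.2.2⟩⟩)

open Filter Topology in
theorem exists_mem_halfOpen {T : Finset Rect} {R : Rect} (h : IsTiling T R) {x y : ℝ}
    (hx : (x, y) ∈ R.halfOpen) : ∃ A ∈ T, (x, y) ∈ A.halfOpen := by
  have key : ∀ a b : ℝ, ∀ᶠ ε in 𝓝[>] (0 : ℝ), a < b → a < b - ε := by
    intro a b
    by_cases hab : a < b
    · filter_upwards [nhdsWithin_le_nhds (Iio_mem_nhds (sub_pos.2 hab))] with ε hε _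
      rw [Set.mem_Iio] at hε
      linarith
    · exact Eventually.of_forall fun _ h => absurd h hab
  have hT : ∀ᶠ ε in 𝓝[>] (0 : ℝ), ∀ A ∈ T,
      (A.right < x → A.right < x - ε) ∧ (A.top < y → A.top < y - ε) :=
    (eventually_all_finset T).2 fun A _ => (key _ _).and (key _ _)
  obtain ⟨ε, ⟨⟨hT, hl⟩, hb⟩, hε⟩ := (((hT.and (key R.left x)).and (key R.bottom y)).and
    self_mem_nhdsWithin).exists
  replace hε : 0 < ε := hε
  rw [Rect.mem_halfOpen] at hx
  -- Shifting the point slightly down and to the left puts it in the closed region covered by `T`,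
  -- without crossing any right or top side that it was not already beyond.
  have hmem : (x - ε, y - ε) ∈ R.toSet := Rect.mem_toSet.2
    ⟨⟨(hl hx.1.1).le, by linarith [hx.1.2]⟩, ⟨(hb hx.2.1).le, by linarith [hx.2.2]⟩⟩
  rw [← h.1, Set.mem_iUnion₂] at hmem
  obtain ⟨A, hA, hmA⟩ := hmem
  rw [Rect.mem_toSet] at hmA
  refine ⟨A, hA, Rect.mem_halfOpen.2 ⟨⟨by linarith [hmA.1.1], ?_⟩, ⟨by linarith [hmA.2.1], ?_⟩⟩⟩
  · by_contra hlt
    linarith [(hT A hA).1 (not_le.1 hlt), hmA.1.2]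
  · by_contra hlt
    linarith [(hT A hA).2 (not_le.1 hlt), hmA.2.2]

/-- On a finite set of reals every function is the cumulative sum of some weights. -/
theorem exists_cumulative_weights {M : Type*} [AddCommGroup M] (F : ℝ → M) (X : Finset ℝ) :
    ∃ δ : ℝ → M, ∀ r ∈ X, ∑ x ∈ X with x ≤ r, δ x = F r := by
  induction X using Finset.induction_on_max with
  | empty => exact ⟨0, by simp⟩
  | insert a X ha ih =>
    obtain ⟨δ, hδ⟩ := ih
    have haX : a ∉ X := fun h => lt_irrefl a (ha a h)
    have hne : ∀ x ∈ X, x ≠ a := fun x hx => (ha x hx).ne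
    refine ⟨Function.update δ a (F a - ∑ x ∈ X, δ x), fun r hr => ?_⟩
    have hsum : ∀ Y ⊆ X, ∑ x ∈ Y, Function.update δ a (F a - ∑ x ∈ X, δ x) x = ∑ x ∈ Y, δ x :=
      fun Y hY => Finset.sum_congr rfl fun x hx => Function.update_of_ne (hne x (hY hx)) _ _
    rcases Finset.mem_insert.1 hr with rfl | hr
    · rw [Finset.filter_true_of_mem, Finset.sum_insert haX, hsum X subset_rfl]
      · simp
      · intro x hx
        rcases Finset.mem_insert.1 hx with rfl | hx
        exacts [le_rfl, (ha x hx).le]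
    · rw [Finset.filter_insert, if_neg (not_le.2 (ha r hr)), hsum _ (Finset.filter_subset _ _),
        hδ r hr]

theorem exists_increment_weights {M : Type*} [AddCommGroup M] (F : ℝ → M) (X : Finset ℝ) :
    ∃ δ : ℝ → M, ∀ l ∈ X, ∀ r ∈ X, l ≤ r →
      ∑ x ∈ X with l < x ∧ x ≤ r, δ x = F r - F l := by
  obtain ⟨δ, hδ⟩ := exists_cumulative_weights F X
  refine ⟨δ, fun l hl r hr hlr => ?_⟩
  rw [← hδ l hl, ← hδ r hr, eq_sub_iff_add_eq, ← Finset.sum_union]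
  · congr 1
    ext x
    simp only [Finset.mem_union, Finset.mem_filter]
    constructor
    · rintro (h | h)
      exacts [⟨h.1, h.2.2⟩, ⟨h.1, h.2.trans hlr⟩]
    · rintro ⟨h1, h2⟩
      rcases lt_or_ge l x with h | h
      exacts [.inl ⟨h1, h, h2⟩, .inr ⟨h1, h⟩]
  · rw [Finset.disjoint_left]
    intro x hx hx'
    exact absurd (Finset.mem_filter.1 hx').2 (not_le.2 (Finset.mem_filter.1 hx).2.1)

/-- For additive `f` and `g`, not necessarily linear, the "area" `f (width) * g (height)` is
additive under tilings. The grid spanned by all the sides of the tiles is split into cells, each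
of which is contained in exactly one half-open tile. -/
theorem IsTiling.sum_mul {M : Type*} [CommRing M] {T : Finset Rect} {R : Rect}
    (h : IsTiling T R) (f g : ℝ →+ M) :
    f (R.right - R.left) * g (R.top - R.bottom) =
      ∑ A ∈ T, f (A.right - A.left) * g (A.top - A.bottom) := by
  classical
  set T' := insert R T
  set X : Finset ℝ := T'.image Rect.left ∪ T'.image Rect.right
  set Y : Finset ℝ := T'.image Rect.bottom ∪ T'.image Rect.top
  obtain ⟨δ, hδ⟩ := exists_increment_weights f X
  obtain ⟨η, hη⟩ := exists_increment_weights g Y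
  have cell : ∀ A ∈ T', f (A.right - A.left) * g (A.top - A.bottom) =
      ∑ p ∈ X ×ˢ Y, if p ∈ A.halfOpen then δ p.1 * η p.2 else 0 := by
    intro A hA
    rw [map_sub, map_sub,
      ← hδ A.left (Finset.mem_union_left _ (Finset.mem_image_of_mem _ hA)) A.right
        (Finset.mem_union_right _ (Finset.mem_image_of_mem _ hA)) A.left_lt_right.le,
      ← hη A.bottom (Finset.mem_union_left _ (Finset.mem_image_of_mem _ hA)) A.top
        (Finset.mem_union_right _ (Finset.mem_image_of_mem _ hA)) A.bottom_lt_top.le,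
      Finset.sum_mul_sum, ← Finset.sum_product', ← Finset.filter_product, Finset.sum_filter]
    refine Finset.sum_congr rfl fun p _ => ?_
    simp only [← Rect.mem_halfOpen, Prod.mk.eta]
  rw [cell R (Finset.mem_insert_self _ _),
    Finset.sum_congr rfl fun A hA => cell A (Finset.mem_insert_of_mem hA), Finset.sum_comm]
  refine Finset.sum_congr rfl fun p _ => ?_
  split_ifs with hp
  · obtain ⟨A, hA, hpA⟩ := exists_mem_halfOpen h hp
    rw [Finset.sum_eq_single_of_mem A hA, if_pos hpA]
    intro B hB hne
    exact if_neg fun hpB => hne (eq_of_mem_halfOpen h hB hA hpB hpA)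
  · refine (Finset.sum_eq_zero fun A hA => if_neg fun hpA => hp ?_).symm
    obtain ⟨h1, h2, h3, h4⟩ := Rect.bounds_of_subset (h.subset hA)
    obtain ⟨⟨h5, h6⟩, ⟨h7, h8⟩⟩ := Rect.mem_halfOpen.1 hpA
    exact Rect.mem_halfOpen.2 ⟨⟨h1.trans_lt h5, h6.trans h2⟩, ⟨h3.trans_lt h7, h8.trans h4⟩⟩

/-! ### Twisted area functionals and the conjugates of `c ^ 2` -/

section Conjugates

open IntermediateField Polynomial ComplexConjugate

/-- A field embedding `ℚ(w) → ℂ` with `w ↦ z` gives an additive map on all of `ℝ` that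
intertwines multiplication by `w` with multiplication by `z`: compose it with a `ℚ(w)`-linear
functional on `ℝ`. -/
theorem exists_additive_semilinear {w b : ℝ} (hb : b ≠ 0) (φ : ℚ⟮w⟯ →+* ℂ) :
    ∃ f : ℝ →+ ℂ, f b = 1 ∧ ∀ x, f (w * x) = φ (AdjoinSimple.gen ℚ w) * f x := by
  obtain ⟨l, hl⟩ := Module.Projective.exists_dual_ne_zero ℚ⟮w⟯ hb
  refine ⟨φ.toAddMonoidHom.comp ((l b)⁻¹ • l).toAddMonoidHom, ?_, fun x => ?_⟩
  · simp [hl]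
  · have : w * x = AdjoinSimple.gen ℚ w • x := by
      rw [Algebra.smul_def, AdjoinSimple.algebraMap_gen]
    simp only [AddMonoidHom.coe_comp, Function.comp_apply, LinearMap.toAddMonoidHom_coe, this,
      map_smul, smul_eq_mul, RingHom.toAddMonoidHom_eq_coe, AddMonoidHom.coe_coe, map_mul]

/-- The rectangle `R` of ratio `c` is tiled by `T`, all tiles have
ratio `c` or `1 / c`, and some tile has ratio `1 / c`. -/
structure IsMixedTiling (c : ℝ) (T : Finset Rect) (R : Rect) : Prop where
  isTiling : IsTiling T R
  ratio_eq : R.ratio = c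
  ratio_tile : ∀ A ∈ T, A.ratio = c ∨ A.ratio = 1 / c
  exists_ratio : ∃ A ∈ T, A.ratio = 1 / c

theorem Rect.width_eq {R : Rect} {x : ℝ} (h : R.ratio = x) :
    R.right - R.left = x * (R.top - R.bottom) := by
  rw [← h, Rect.ratio, div_mul_cancel₀]
  exact (sub_pos.2 R.bottom_lt_top).ne'

/-- Stretching heights by `c` turns `R` and the tiles of ratio `c` into squares, and a tile of
ratio `1 / c` and width `b` into a `b × c ^ 2 b` rectangle. Here `U` collects the former tiles and
`V` the latter. -/
theorem IsMixedTiling.sum_mul {c : ℝ} (hc : 0 < c) {T : Finset Rect} {R : Rect}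
    (h : IsMixedTiling c T R) : ∃ U V : Finset Rect, V.Nonempty ∧
      ∀ {M : Type} [CommRing M] (f g : ℝ →+ M),
      f (R.right - R.left) * g (R.right - R.left) =
        ∑ A ∈ U, f (A.right - A.left) * g (A.right - A.left) +
        ∑ A ∈ V, f (A.right - A.left) * g (c ^ 2 * (A.right - A.left)) := by
  classical
  refine ⟨{A ∈ T | ¬ A.ratio = 1 / c}, {A ∈ T | A.ratio = 1 / c}, ?_, fun {M} _ f g => ?_⟩
  · obtain ⟨A, hA, hr⟩ := h.exists_ratio
    exact ⟨A, Finset.mem_filter.2 ⟨hA, hr⟩⟩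
  · have key := h.isTiling.sum_mul f (g.comp (AddMonoidHom.mulLeft c))
    simp only [AddMonoidHom.coe_comp, Function.comp_apply, AddMonoidHom.coe_mulLeft] at key
    rw [← Rect.width_eq h.ratio_eq, ← Finset.sum_filter_not_add_sum_filter _
      (fun A : Rect => A.ratio = 1 / c)] at key
    rw [key]
    congr 1
    · refine Finset.sum_congr rfl fun A hA => ?_
      rw [Finset.mem_filter] at hA
      rw [← Rect.width_eq ((h.ratio_tile A hA.1).resolve_right hA.2)]
    · refine Finset.sum_congr rfl fun A hA => ?_
      rw [Rect.width_eq (Finset.mem_filter.1 hA).2]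
      congr 2
      field_simp

/-- If `w = c ^ 2` could be sent to a non-real `z`, then the imaginary part of the twisted area
`f (width) * conj (f (height))` would be `0` on `R` but not on the tiles. -/
theorem IsMixedTiling.im_eq_zero {c : ℝ} (hc : 0 < c) {T : Finset Rect} {R : Rect}
    (h : IsMixedTiling c T R) (φ : ℚ⟮c ^ 2⟯ →+* ℂ) :
    (φ (AdjoinSimple.gen ℚ (c ^ 2))).im = 0 := by
  obtain ⟨U, V, ⟨B, hB⟩, hsum⟩ := h.sum_mul hc
  obtain ⟨f, hfB, hf⟩ := exists_additive_semilinear (sub_pos.2 B.left_lt_right).ne' φ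
  set z := φ (AdjoinSimple.gen ℚ (c ^ 2))
  have key := congrArg Complex.im (hsum f ((starRingEnd ℂ).toAddMonoidHom.comp f))
  simp only [RingHom.toAddMonoidHom_eq_coe, AddMonoidHom.coe_comp, AddMonoidHom.coe_coe,
    Function.comp_apply, hf, map_mul, Complex.mul_conj, Complex.add_im,
    Complex.ofReal_im, mul_left_comm _ (conj z),
    zero_add, ← Finset.mul_sum,
    ← Complex.ofReal_sum] at key
  rw [Complex.im_mul_ofReal, Complex.conj_im] at key
  have hpos : 0 < ∑ A ∈ V, Complex.normSq (f (A.right - A.left)) :=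
    Finset.sum_pos' (fun A _ => Complex.normSq_nonneg _) ⟨B, hB, by simp [hfB]⟩
  have := (mul_eq_zero.1 key.symm).resolve_right hpos.ne'
  linarith

/-- If `w = c ^ 2` could be sent to another positive `z`, the areas formed with the identity and
with `f` would violate the Cauchy–Schwarz inequality. -/
theorem IsMixedTiling.not_pos {c : ℝ} (hc : 0 < c) {T : Finset Rect} {R : Rect}
    (h : IsMixedTiling c T R) (φ : ℚ⟮c ^ 2⟯ →+* ℂ) {z : ℝ}
    (hφ : φ (AdjoinSimple.gen ℚ (c ^ 2)) = z) (hz : 0 < z) (hne : z ≠ c ^ 2) : False := by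
  obtain ⟨U, V, ⟨B, hB⟩, hsum⟩ := h.sum_mul hc
  obtain ⟨f', hfB', hf'⟩ := exists_additive_semilinear (sub_pos.2 B.left_lt_right).ne' φ
  set f : ℝ →+ ℝ := Complex.reAddGroupHom.comp f'
  have hfB : f (B.right - B.left) = 1 := by simp [f, hfB']
  have hf : ∀ x, f (c ^ 2 * x) = z * f x := fun x => by simp [f, hf', hφ]
  have e1 := hsum f f
  have e2 := hsum f (AddMonoidHom.id ℝ)
  have e3 := hsum (AddMonoidHom.id ℝ) f
  have e4 := hsum (AddMonoidHom.id ℝ) (AddMonoidHom.id ℝ)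
  simp only [AddMonoidHom.id_apply, hf, mul_left_comm _ z, mul_left_comm _ (c ^ 2),
    ← Finset.mul_sum] at e1 e2 e3 e4
  set S := R.right - R.left
  have hS : 0 < S := sub_pos.2 R.left_lt_right
  have hcs := Finset.sum_mul_sq_le_sq_mul_sq U (fun A : Rect => A.right - A.left)
    (fun A => f (A.right - A.left))
  have hV1 : 0 < ∑ A ∈ V, f (A.right - A.left) * f (A.right - A.left) :=
    Finset.sum_pos' (fun A _ => mul_self_nonneg _) ⟨B, hB, by simp [hfB]⟩
  have hV2 : 0 ≤ ∑ A ∈ V, (A.right - A.left) * (A.right - A.left) :=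
    Finset.sum_nonneg fun A _ => mul_self_nonneg _
  have hU : 0 ≤ ∑ A ∈ U, f (A.right - A.left) * f (A.right - A.left) :=
    Finset.sum_nonneg fun A _ => mul_self_nonneg _
  simp only [pow_two (_ - _ : ℝ), pow_two (f _)] at hcs
  simp only [mul_comm (f _) (_ - _)] at e2
  have hV0 : ∑ A ∈ V, (A.right - A.left) * f (A.right - A.left) = 0 := by
    have : (z - c ^ 2) * ∑ A ∈ V, (A.right - A.left) * f (A.right - A.left) = 0 := by
      linarith [mul_comm (f S) S]
    exact (mul_eq_zero.1 this).resolve_left (sub_ne_zero.2 hne)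
  rw [hV0, mul_zero, add_zero] at e3
  rw [← e3] at hcs
  have a1 : ∑ A ∈ U, (A.right - A.left) * (A.right - A.left) ≤ S * S := by
    nlinarith [mul_nonneg (sq_nonneg c) hV2]
  have a2 : ∑ A ∈ U, f (A.right - A.left) * f (A.right - A.left) < f S * f S := by
    nlinarith [mul_pos hz hV1]
  have a3 := mul_le_mul_of_nonneg_right a1 hU
  have a4 := mul_lt_mul_of_pos_left a2 (mul_pos hS hS)
  nlinarith

theorem exists_ringHom_gen_eq {F E : Type*} [Field F] [Field E] [Algebra F E] {a b : E}
    (ha : Transcendental F a) (hb : Transcendental F b) :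
    ∃ φ : F⟮a⟯ →+* E, φ (AdjoinSimple.gen F a) = b := by
  let e := (RatFunc.algEquivOfTranscendental a ha).symm.trans
    (RatFunc.algEquivOfTranscendental b hb)
  refine ⟨(algebraMap F⟮b⟯ E).comp e.toRingEquiv.toRingHom, ?_⟩
  simp [e, RatFunc.algEquivOfTranscendental_symm_gen, RatFunc.algEquivOfTranscendental_X]

theorem IsMixedTiling.isAlgebraic {c : ℝ} (hc : 0 < c) {T : Finset Rect} {R : Rect}
    (h : IsMixedTiling c T R) : IsAlgebraic ℚ (c ^ 2) := by
  by_contra htr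
  have htr' : Transcendental ℚ (c ^ 2 + 1) := fun halg => htr <| by
    simpa using halg.sub (isAlgebraic_one (R := ℚ))
  -- A transcendental `c ^ 2` can be sent to any transcendental number, such as `c ^ 2 + 1`.
  obtain ⟨φ, hφ⟩ := exists_ringHom_gen_eq htr htr'
  refine h.not_pos hc (Complex.ofRealHom.comp φ) (z := c ^ 2 + 1) ?_ (by positivity) (by simp)
  rw [RingHom.comp_apply, hφ, Complex.ofRealHom_eq_coe]

theorem IsMixedTiling.neg_of_aeval_minpoly {c : ℝ} (hc : 0 < c) {T : Finset Rect} {R : Rect}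
    (h : IsMixedTiling c T R) {z : ℂ} (hz : aeval z (minpoly ℚ (c ^ 2)) = 0)
    (hne : z ≠ ((c ^ 2 : ℝ) : ℂ)) : ∃ r : ℝ, r < 0 ∧ z = r := by
  have hint : IsIntegral ℚ (c ^ 2) := (h.isAlgebraic hc).isIntegral
  let ψ : ℚ⟮c ^ 2⟯ →ₐ[ℚ] ℂ := (algHomAdjoinIntegralEquiv ℚ hint).symm
    ⟨z, (mem_aroots.2 ⟨minpoly.ne_zero hint, hz⟩)⟩
  have hψ : ψ (AdjoinSimple.gen ℚ (c ^ 2)) = z :=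
    algHomAdjoinIntegralEquiv_symm_apply_gen ℚ hint _
  have him : z.im = 0 := by
    have := h.im_eq_zero hc (ψ : ℚ⟮c ^ 2⟯ →+* ℂ)
    rwa [RingHom.coe_coe, hψ] at this
  have hre : z = (z.re : ℂ) := Complex.ext rfl him
  refine ⟨z.re, ?_, hre⟩
  rcases lt_trichotomy z.re 0 with hlt | h0 | hgt
  · exact hlt
  · exfalso
    rw [h0, Complex.ofReal_zero] at hre
    rw [hre, map_eq_zero] at hψ
    have := congrArg (algebraMap ℚ⟮c ^ 2⟯ ℝ) hψ
    rw [AdjoinSimple.algebraMap_gen, map_zero] at this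
    exact (pow_pos hc 2).ne' this
  · exfalso
    refine h.not_pos hc (ψ : ℚ⟮c ^ 2⟯ →+* ℂ) (hψ.trans hre) hgt fun heq => hne ?_
    rw [hre, heq]

end Conjugates

/-! ### Building tilings from continued fractions -/

/-- The reflection of a rectangle in the diagonal. -/
def Rect.transpose (R : Rect) : Rect :=
  ⟨R.bottom, R.top, R.left, R.right, R.bottom_lt_top, R.left_lt_right⟩

theorem Rect.ratio_transpose (R : Rect) : R.transpose.ratio = 1 / R.ratio := by
  simp [Rect.ratio, Rect.transpose]

theorem IsTiling.singleton (R : Rect) : IsTiling {R} R := by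
  simp [IsTiling]

open Classical in
theorem IsTiling.transpose {T : Finset Rect} {R : Rect} (h : IsTiling T R) :
    IsTiling (T.image Rect.transpose) R.transpose := by
  constructor
  · ext ⟨x, y⟩
    have := Set.ext_iff.1 h.1 (y, x)
    simp only [Set.mem_iUnion, exists_prop, Rect.mem_toSet] at this
    simp only [Set.mem_iUnion, exists_prop, Finset.mem_image, Rect.mem_toSet,
      exists_exists_and_eq_and, Rect.transpose]
    rw [and_comm (a := R.bottom ≤ x ∧ x ≤ R.top), ← this]
    exact exists_congr fun A => and_congr_right fun _ => and_comm
  · intro A' hA' B' hB' hne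
    obtain ⟨A, hA, rfl⟩ := Finset.mem_image.1 hA'
    obtain ⟨B, hB, rfl⟩ := Finset.mem_image.1 hB'
    have hd : Disjoint (interior A.toSet) (interior B.toSet) :=
      h.2 hA hB fun e => hne (congrArg _ e)
    exact Set.disjoint_left.2 fun ⟨x, y⟩ h1 h2 => Set.disjoint_left.1 hd
      (Rect.mem_interior.2 (Rect.mem_interior.1 h1).symm)
      (Rect.mem_interior.2 (Rect.mem_interior.1 h2).symm)

open Classical in
/-- Tilings of the two parts into which a vertical line cuts a rectangle combine. -/
theorem IsTiling.union {T₁ T₂ : Finset Rect} {R R₁ R₂ : Rect} (h₁ : IsTiling T₁ R₁)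
    (h₂ : IsTiling T₂ R₂) (hl : R₁.left = R.left) (hm : R₁.right = R₂.left)
    (hr : R₂.right = R.right) (hb₁ : R₁.bottom = R.bottom) (hb₂ : R₂.bottom = R.bottom)
    (ht₁ : R₁.top = R.top) (ht₂ : R₂.top = R.top) : IsTiling (T₁ ∪ T₂) R := by
  have cross : ∀ A ∈ T₁, ∀ B ∈ T₂, Disjoint (interior A.toSet) (interior B.toSet) := by
    intro A hA B hB
    refine Set.disjoint_left.2 fun ⟨x, y⟩ hx hx' => ?_
    have := (Rect.bounds_of_subset (h₁.subset hA)).2.1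
    have := (Rect.bounds_of_subset (h₂.subset hB)).1
    have := (Rect.mem_interior.1 hx).1.2
    have := (Rect.mem_interior.1 hx').1.1
    linarith
  constructor
  · rw [Finset.set_biUnion_union, h₁.1, h₂.1]
    ext ⟨x, y⟩
    have := R₁.left_lt_right
    have := R₂.left_lt_right
    rw [Set.mem_union, Rect.mem_toSet, Rect.mem_toSet, Rect.mem_toSet, hb₁, hb₂, ht₁, ht₂, hl,
      hr, ← hm]
    constructor
    · rintro (⟨⟨h1, h2⟩, h3⟩ | ⟨⟨h1, h2⟩, h3⟩)
      exacts [⟨⟨h1, by linarith⟩, h3⟩, ⟨⟨by linarith, h2⟩, h3⟩]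
    · rintro ⟨⟨h1, h2⟩, h3⟩
      rcases le_total x R₁.right with h | h
      exacts [.inl ⟨⟨h1, h⟩, h3⟩, .inr ⟨⟨h, h2⟩, h3⟩]
  · intro A hA B hB hne
    rcases Finset.mem_union.1 hA with hA | hA <;> rcases Finset.mem_union.1 hB with hB | hB
    · exact h₁.2 hA hB hne
    · exact cross A hA B hB
    · exact (cross B hB A hA).symm
    · exact h₂.2 hA hB hne

/-- Every rectangle of ratio `x` has a tiling by rectangles of ratio `c` or `1 / c`, at least one
of which has ratio `s`. -/
def Tileable (c x s : ℝ) : Prop :=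
  ∀ R : Rect, R.ratio = x → ∃ T : Finset Rect, IsTiling T R ∧
    (∀ A ∈ T, A.ratio = c ∨ A.ratio = 1 / c) ∧ ∃ A ∈ T, A.ratio = s

theorem Tileable.refl (c : ℝ) : Tileable c c c := fun R hR =>
  ⟨{R}, .singleton R, by simp [hR], R, by simp, hR⟩

theorem Tileable.one_div {c x s : ℝ} (h : Tileable c x s) : Tileable c (1 / x) (1 / s) := by
  classical
  intro R hR
  obtain ⟨T, hT, hr, A, hA, hs⟩ := h R.transpose (by rw [R.ratio_transpose, hR, one_div_one_div])
  refine ⟨T.image Rect.transpose, hT.transpose, ?_, A.transpose,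
    Finset.mem_image_of_mem _ hA, by rw [A.ratio_transpose, hs]⟩
  intro B' hB'
  obtain ⟨B, hB, rfl⟩ := Finset.mem_image.1 hB'
  rw [B.ratio_transpose]
  rcases hr B hB with h | h
  · exact .inr (by rw [h])
  · exact .inl (by rw [h, one_div_one_div])

theorem Tileable.add {c x y s t : ℝ} (hx : 0 < x) (hy : 0 < y) (h₁ : Tileable c x s)
    (h₂ : Tileable c y t) : Tileable c (x + y) s := by
  classical
  intro R hR
  have hH : 0 < R.top - R.bottom := sub_pos.2 R.bottom_lt_top
  have hW := Rect.width_eq hR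
  have hxH := mul_pos hx hH
  have hyH := mul_pos hy hH
  let R₁ : Rect := ⟨R.left, R.left + x * (R.top - R.bottom), R.bottom, R.top,
    by linarith, R.bottom_lt_top⟩
  let R₂ : Rect := ⟨R.left + x * (R.top - R.bottom), R.right, R.bottom, R.top,
    by linarith, R.bottom_lt_top⟩
  obtain ⟨T₁, hT₁, hr₁, A, hA, hs⟩ := h₁ R₁ (by simp [Rect.ratio, R₁, hH.ne'])
  obtain ⟨T₂, hT₂, hr₂, -⟩ := h₂ R₂ (by
    rw [Rect.ratio, div_eq_iff hH.ne']
    simp only [R₂]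
    linarith)
  refine ⟨T₁ ∪ T₂, hT₁.union hT₂ rfl rfl rfl rfl rfl rfl rfl, ?_, A,
    Finset.mem_union_left _ hA, hs⟩
  intro B hB
  exact (Finset.mem_union.1 hB).elim (hr₁ B) (hr₂ B)

theorem Tileable.nat_mul {c x s : ℝ} (hx : 0 < x) (h : Tileable c x s) {n : ℕ} (hn : 0 < n) :
    Tileable c (n * x) s := by
  induction n, hn using Nat.le_induction with
  | base => simpa using h
  | succ n hn ih =>
    have hn' : (0 : ℝ) < n := Nat.cast_pos.2 hn
    have := ih.add (by positivity) hx h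
    rwa [show ((n + 1 : ℕ) : ℝ) * x = n * x + x by push_cast; ring]

theorem Tileable.rat_mul {c x s : ℝ} (hx : 0 < x) (h : Tileable c x s) {q : ℚ} (hq : 0 < q) :
    Tileable c (q * x) s := by
  have hnum : 0 < q.num.toNat := by simpa using Rat.num_pos.2 hq
  have hden : (0 : ℝ) < q.den := Nat.cast_pos.2 q.den_pos
  -- Division by the denominator is multiplication conjugated by the transpose.
  have h1 := (h.one_div.nat_mul (one_div_pos.2 hx) q.den_pos).one_div
  have h2 := h1.nat_mul (by positivity) hnum
  rw [one_div_one_div] at h2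
  convert h2 using 1
  have hcast : ((q.num.toNat : ℕ) : ℝ) = (q.num : ℝ) := by
    rw [← Int.cast_natCast, Int.toNat_of_nonneg (Rat.num_pos.2 hq).le]
  rw [hcast, Rat.cast_def]
  field_simp

theorem contFrac_pos {c : ℝ} (hc : 0 < c) : ∀ {d : List ℚ}, d ≠ [] → (∀ q ∈ d, 0 < q) →
    0 < contFrac c d
  | [], h, _ => absurd rfl h
  | [q], _, hq => by
    have : (0 : ℝ) < q := Rat.cast_pos.2 (hq q (by simp))
    simp only [contFrac]
    positivity
  | q :: e :: l, _, hq => by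
    have : (0 : ℝ) < q := Rat.cast_pos.2 (hq q (by simp))
    have := contFrac_pos hc (d := e :: l) (by simp) fun p hp => hq p (List.mem_cons_of_mem _ hp)
    simp only [contFrac]
    positivity

theorem tileable_contFrac {c : ℝ} (hc : 0 < c) : ∀ {d : List ℚ}, d ≠ [] → (∀ q ∈ d, 0 < q) →
    Tileable c (contFrac c d) c
  | [], h, _ => absurd rfl h
  | [q], _, hq => (Tileable.refl c).rat_mul hc (hq q (by simp))
  | q :: e :: l, _, hq => by
    have hq0 : (0 : ℝ) < q := Rat.cast_pos.2 (hq q (by simp))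
    have htail : ∀ p ∈ e :: l, 0 < p := fun p hp => hq p (List.mem_cons_of_mem _ hp)
    have h1 := (Tileable.refl c).rat_mul hc (hq q (by simp))
    have h2 := (tileable_contFrac hc (by simp) htail).one_div
    exact h1.add (mul_pos hq0 hc) (one_div_pos.2 (contFrac_pos hc (by simp) htail)) h2

theorem exists_tiling_of_contFrac {c : ℝ} (hc : 0 < c) {d : List ℚ} (hd : d ≠ [])
    (hpos : ∀ q ∈ d, 0 < q) (h : 1 / contFrac c d = c) :
    ∃ (R : Rect) (T : Finset Rect), R.ratio = c ∧ IsTiling T R ∧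
      (∀ A ∈ T, A.ratio = c ∨ A.ratio = 1 / c) ∧ (∃ A ∈ T, A.ratio = 1 / c) := by
  have hT := (tileable_contFrac hc hd hpos).one_div
  rw [h] at hT
  have hR : (⟨0, c, 0, 1, hc, one_pos⟩ : Rect).ratio = c := by simp [Rect.ratio]
  obtain ⟨T, hT⟩ := hT _ hR
  exact ⟨_, T, hR, hT⟩

/-! ### Interlacing polynomials and the Stieltjes continued fraction -/

section Stieltjes

open Polynomial Finset

theorem lt_of_lt_of_chain {t : ℕ → ℝ} {m : ℕ} (ht : ∀ i, i + 1 < m → t (i + 1) < t i) {i j : ℕ}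
    (hij : i < j) (hj : j < m) : t j < t i := by
  induction j, hij using Nat.le_induction with
  | base => exact ht i hj
  | succ j hij ih => exact (ht j hj).trans (ih (by omega))

theorem sign_prod_sub {q : ℕ → ℝ} {m k : ℕ} {x : ℝ} (hk : k ≤ m) (h1 : ∀ i < k, x < q i)
    (h2 : ∀ i < m, k ≤ i → q i < x) : 0 < (-1) ^ k * ∏ i ∈ range m, (x - q i) := by
  rw [← prod_range_mul_prod_Ico _ hk, ← mul_assoc]
  refine mul_pos ?_ (prod_pos fun i hi => sub_pos.2 (h2 i (mem_Ico.1 hi).2 (mem_Ico.1 hi).1))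
  rw [← card_range k, ← prod_const, card_range, ← prod_mul_distrib]
  exact prod_pos fun i hi => by linarith [h1 i (mem_range.1 hi)]

theorem map_eq_C_mul_prod {F : ℚ[X]} {m : ℕ} (hF : F.natDegree ≤ m) {r : ℕ → ℝ}
    (hr : ∀ i, i + 1 < m → r (i + 1) < r i) (hroot : ∀ i < m, aeval (r i) F = 0) :
    F.map (algebraMap ℚ ℝ) = C (F.leadingCoeff : ℝ) * ∏ i ∈ range m, (X - C (r i)) := by
  have hdvd : ∏ i ∈ range m, (X - C (r i)) ∣ F.map (algebraMap ℚ ℝ) := by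
    refine prod_dvd_of_coprime (fun i hi j hj hij => ?_) fun i hi => ?_
    · rw [coe_range, Set.mem_Iio] at hi hj
      refine isCoprime_X_sub_C_of_isUnit_sub (sub_ne_zero.2 ?_).isUnit
      rcases lt_or_gt_of_ne hij with h | h
      exacts [(lt_of_lt_of_chain hr h hj).ne', (lt_of_lt_of_chain hr h hi).ne]
    · rw [dvd_iff_isRoot, IsRoot, eval_map_algebraMap]
      exact hroot i (mem_range.1 hi)
  have := eq_leadingCoeff_mul_of_monic_of_dvd_of_natDegree_le (monic_prod_X_sub_C _ _) hdvd
    (by rw [natDegree_map, natDegree_finsetProd_X_sub_C_eq_card, card_range]; exact hF)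
  rwa [leadingCoeff_map] at this

theorem aeval_eq_of_map_eq {F : ℚ[X]} {m : ℕ} {r : ℕ → ℝ}
    (h : F.map (algebraMap ℚ ℝ) = C (F.leadingCoeff : ℝ) * ∏ i ∈ range m, (X - C (r i)))
    (x : ℝ) : aeval x F = F.leadingCoeff * ∏ i ∈ range m, (x - r i) := by
  rw [← eval_map_algebraMap, h]
  simp [eval_prod]

/-- A polynomial of degree at most `m` whose signs alternate along `m + 1` decreasing points, and
which is positive at the first of them, has exactly `m` roots, strictly between these points. -/
theorem exists_interlacing_roots {F : ℚ[X]} {m : ℕ} (hF : F.natDegree ≤ m) {t : ℕ → ℝ}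
    (ht : ∀ i < m, t (i + 1) < t i) (hs : ∀ k ≤ m, 0 < (-1) ^ k * aeval (t k) F) :
    ∃ r : ℕ → ℝ, (∀ i < m, t (i + 1) < r i ∧ r i < t i) ∧ F.natDegree = m ∧
      0 < F.leadingCoeff ∧ ∀ x : ℝ, aeval x F = F.leadingCoeff * ∏ i ∈ range m, (x - r i) := by
  have hroot : ∀ i, ∃ r, i < m → (t (i + 1) < r ∧ r < t i) ∧ aeval r F = 0 := by
    intro i
    by_cases hi : i < m
    · have h0 := hs i hi.le
      have h1 := hs (i + 1) hi
      rw [pow_succ, mul_neg_one, neg_mul] at h1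
      obtain ⟨r, hr, hr0⟩ := intermediate_value_Ioo (ht i hi).le
        (f := fun x : ℝ => (-1) ^ i * aeval x F) (by fun_prop) ⟨neg_pos.1 h1, h0⟩
      exact ⟨r, fun _ => ⟨hr, (mul_eq_zero.1 hr0).resolve_left (by simp)⟩⟩
    · exact ⟨0, fun h => absurd h hi⟩
  choose r hr using hroot
  have hmap := map_eq_C_mul_prod hF (r := r)
    (fun i hi => (hr (i + 1) hi).1.2.trans (hr i (by omega)).1.1) fun i hi => (hr i hi).2
  have heq := aeval_eq_of_map_eq hmap
  have hlt : ∀ i < m, r i < t 0 := fun i hi => by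
    refine (hr i hi).1.2.trans_le ?_
    rcases Nat.eq_zero_or_pos i with rfl | h
    · exact le_rfl
    · exact (lt_of_lt_of_chain (m := m + 1) (fun j hj => ht j (by omega)) h (by omega)).le
  have hlc : 0 < F.leadingCoeff := by
    have h0 := hs 0 (Nat.zero_le _)
    rw [pow_zero, one_mul, heq] at h0
    exact Rat.cast_pos.1 (pos_of_mul_pos_left h0
      (prod_nonneg fun i hi => sub_nonneg.2 (hlt i (mem_range.1 hi)).le))
  refine ⟨r, fun i hi => (hr i hi).1, ?_, hlc, heq⟩
  rw [← natDegree_map (algebraMap ℚ ℝ), hmap, natDegree_C_mul (Rat.cast_pos.2 hlc).ne',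
    natDegree_finsetProd_X_sub_C_eq_card, card_range]

theorem natDegree_sub_le_of_coeff_eq {A B : ℚ[X]} {n : ℕ} (hA : A.natDegree ≤ n + 1)
    (hB : B.natDegree ≤ n + 1) (h : A.coeff (n + 1) = B.coeff (n + 1)) :
    (A - B).natDegree ≤ n := by
  refine natDegree_le_iff_coeff_eq_zero.2 fun N hN => ?_
  rw [coeff_sub]
  rcases eq_or_lt_of_le (Nat.succ_le_of_lt hN) with rfl | hlt
  · rw [Nat.succ_eq_add_one, h, sub_self]
  · rw [coeff_eq_zero_of_natDegree_lt (hA.trans_lt hlt),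
      coeff_eq_zero_of_natDegree_lt (hB.trans_lt hlt), sub_self]

/-- `Q` has degree `m`, positive leading coefficient and the negative roots
`q 0 > q 1 > ⋯ > q (m - 1)`; `P` has degree `m + 1` and positive leading coefficient, and its
signs at `0, q 0, …, q (m - 1)` alternate, starting with a positive one. This says that the roots
of `P` and `Q` are negative and interlace. -/
structure IsStieltjesPair (P Q : ℚ[X]) (m : ℕ) (q : ℕ → ℝ) : Prop where
  natDegree_left : P.natDegree = m + 1
  leadingCoeff_left : 0 < P.leadingCoeff
  natDegree_right : Q.natDegree = m
  leadingCoeff_right : 0 < Q.leadingCoeff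
  aeval_right : ∀ x : ℝ, aeval x Q = Q.leadingCoeff * ∏ i ∈ range m, (x - q i)
  chain : ∀ i, i + 1 < m → q (i + 1) < q i
  neg : ∀ i < m, q i < 0
  aeval_zero : 0 < aeval (0 : ℝ) P
  sign : ∀ k < m, 0 < (-1) ^ (k + 1) * aeval (q k) P

theorem IsStieltjesPair.aeval_right_pos {P Q : ℚ[X]} {m : ℕ} {q : ℕ → ℝ}
    (h : IsStieltjesPair P Q m q) {x : ℝ} (hx : 0 ≤ x) : 0 < aeval x Q := by
  rw [h.aeval_right]
  refine mul_pos (Rat.cast_pos.2 h.leadingCoeff_right) (prod_pos fun i hi => ?_)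
  linarith [h.neg i (mem_range.1 hi)]

/-- Two Euclidean steps on an interlacing pair: the remainder of `P` by `X * Q` interlaces with
`Q`, and the remainder of `Q` by that remainder interlaces again. Their quotients are the next two
coefficients of the continued fraction. -/
theorem IsStieltjesPair.exists_contFrac {c : ℝ} (hc : 0 < c) {m : ℕ} :
    ∀ {P Q : ℚ[X]} {q : ℕ → ℝ}, IsStieltjesPair P Q m q →
      ∃ d : List ℚ, d ≠ [] ∧ (∀ a ∈ d, 0 < a) ∧
        contFrac c d = aeval (c ^ 2) P / (c * aeval (c ^ 2) Q) := by
  induction m with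
  | zero =>
    intro P Q q h
    have hQ := h.aeval_right (c ^ 2)
    have hP : aeval (c ^ 2) P = P.leadingCoeff * c ^ 2 + P.coeff 0 := by
      conv_lhs => rw [eq_X_add_C_of_natDegree_le_one h.natDegree_left.le]
      simp [leadingCoeff, h.natDegree_left]
    have h0 : 0 < P.coeff 0 := by
      have := h.aeval_zero
      rw [aeval_def, eval₂_at_zero] at this
      exact Rat.cast_pos.1 this
    have hl := h.leadingCoeff_left
    have hr := h.leadingCoeff_right
    refine ⟨[P.leadingCoeff / Q.leadingCoeff, Q.leadingCoeff / P.coeff 0], by simp, ?_, ?_⟩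
    · intro a ha
      simp only [List.mem_cons, List.not_mem_nil, or_false] at ha
      rcases ha with rfl | rfl
      exacts [div_pos hl hr, div_pos hr h0]
    · have h0' : (0 : ℝ) < P.coeff 0 := Rat.cast_pos.2 h0
      have hr' : (0 : ℝ) < Q.leadingCoeff := Rat.cast_pos.2 hr
      rw [hP, hQ]
      simp only [contFrac, range_zero, prod_empty, Rat.cast_div]
      field_simp
  | succ m ih =>
    intro P Q q h
    have hl := h.leadingCoeff_left
    have hr := h.leadingCoeff_right
    set d := P.leadingCoeff / Q.leadingCoeff with hd
    have hd0 : 0 < d := div_pos hl hr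
    set P₁ := P - C d * X * Q with hP₁
    have hP₁x : ∀ x : ℝ, aeval x P₁ = aeval x P - d * x * aeval x Q := fun x => by simp [hP₁]
    have hQq : ∀ k < m + 1, aeval (q k) Q = 0 := fun k hk => by
      rw [h.aeval_right, prod_eq_zero (mem_range.2 hk) (sub_self _), mul_zero]
    have hdeg₁ : P₁.natDegree ≤ m + 1 := by
      refine natDegree_sub_le_of_coeff_eq h.natDegree_left.le ?_ ?_
      · rw [mul_assoc]
        refine (natDegree_C_mul_le _ _).trans (natDegree_mul_le.trans ?_)
        rw [natDegree_X, h.natDegree_right, add_comm]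
      · rw [mul_assoc, coeff_C_mul, coeff_X_mul, ← h.natDegree_left, ← leadingCoeff,
          ← h.natDegree_right, ← leadingCoeff, hd, div_mul_cancel₀ _ hr.ne']
    let t : ℕ → ℝ := fun k => Nat.casesOn k 0 q
    obtain ⟨r, hr₁, hdegP₁, hlP₁, hP₁r⟩ := exists_interlacing_roots hdeg₁ (t := t)
      (fun i hi => by
        cases i with
        | zero => exact h.neg 0 hi
        | succ i => exact h.chain i hi)
      (fun k hk => by
        cases k with
        | zero => simpa [t, hP₁x] using h.aeval_zero
        | succ k =>
          simp only [t]
          rw [hP₁x, hQq k hk, mul_zero, sub_zero]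
          exact h.sign k hk)
    have hrq : ∀ i < m + 1, q i < r i := fun i hi => (hr₁ i hi).1
    have hrq' : ∀ i, i + 1 < m + 1 → r (i + 1) < q i := fun i hi => (hr₁ (i + 1) hi).2
    have hr0 : ∀ i < m + 1, r i < 0 := fun i hi => by
      cases i with
      | zero => exact (hr₁ 0 hi).2
      | succ i => exact (hrq' i hi).trans (h.neg i (by omega))
    have hrch : ∀ i, i + 1 < m + 1 → r (i + 1) < r i := fun i hi =>
      (hrq' i hi).trans (hrq i (by omega))
    set e := Q.leadingCoeff / P₁.leadingCoeff with he
    have he0 : 0 < e := div_pos hr hlP₁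
    set Q₁ := Q - C e * P₁ with hQ₁
    have hQ₁x : ∀ x : ℝ, aeval x Q₁ = aeval x Q - e * aeval x P₁ := fun x => by simp [hQ₁]
    have hdeg₂ : Q₁.natDegree ≤ m := by
      refine natDegree_sub_le_of_coeff_eq h.natDegree_right.le ?_ ?_
      · exact (natDegree_C_mul_le _ _).trans hdeg₁
      · rw [coeff_C_mul, ← hdegP₁, ← leadingCoeff, hdegP₁, ← h.natDegree_right, ← leadingCoeff, he,
          div_mul_cancel₀ _ hlP₁.ne']
    obtain ⟨s, hs, hdegQ₁, hlQ₁, hQ₁s⟩ := exists_interlacing_roots hdeg₂ (t := r)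
      (fun i hi => hrch i (by omega))
      (fun k hk => by
        have hP0 : aeval (r k) P₁ = 0 := by
          rw [hP₁r, prod_eq_zero (mem_range.2 (Nat.lt_succ_of_le hk)) (sub_self _), mul_zero]
        rw [hQ₁x, hP0, mul_zero, sub_zero, h.aeval_right, mul_left_comm]
        refine mul_pos (Rat.cast_pos.2 hr) (sign_prod_sub (by omega) (fun i hi => ?_) ?_)
        · rcases eq_or_lt_of_le (Nat.succ_le_of_lt hi) with rfl | hlt
          · exact hrq' i (by omega)
          · exact (lt_of_lt_of_chain hrch hlt (by omega)).trans (hrq' i (by omega))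
        · intro i hi hki
          rcases eq_or_lt_of_le hki with rfl | hlt
          · exact hrq k hi
          · exact (lt_of_lt_of_chain h.chain hlt hi).trans (hrq k (by omega)))
    have hpair : IsStieltjesPair P₁ Q₁ m s :=
      { natDegree_left := hdegP₁
        leadingCoeff_left := hlP₁
        natDegree_right := hdegQ₁
        leadingCoeff_right := hlQ₁
        aeval_right := hQ₁s
        chain := fun i hi => (hs (i + 1) hi).2.trans (hs i (by omega)).1
        neg := fun i hi => (hs i hi).2.trans (hr0 i (by omega))
        aeval_zero := by simpa [hP₁x] using h.aeval_zero
        sign := fun k hk => by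
          rw [hP₁r, mul_left_comm]
          refine mul_pos (Rat.cast_pos.2 hlP₁) (sign_prod_sub (by omega) (fun i hi => ?_) ?_)
          · rcases eq_or_lt_of_le (Nat.le_of_lt_succ hi) with rfl | hlt
            · exact (hs i hk).2
            · exact (hs k hk).2.trans (lt_of_lt_of_chain hrch hlt (by omega))
          · intro i hi hki
            rcases eq_or_lt_of_le hki with rfl | hlt
            · exact (hs k hk).1
            · exact (lt_of_lt_of_chain hrch hlt hi).trans (hs k hk).1 }
    obtain ⟨l, hl0, hlpos, hlc⟩ := ih hpair
    obtain ⟨a, l, rfl⟩ := List.exists_cons_of_ne_nil hl0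
    refine ⟨d :: e :: a :: l, by simp, ?_, ?_⟩
    · intro b hb
      rcases List.mem_cons.1 hb with rfl | hb
      · exact hd0
      rcases List.mem_cons.1 hb with rfl | hb
      exacts [he0, hlpos b hb]
    · have hQ₁pos := hpair.aeval_right_pos (sq_nonneg c)
      have hQpos := h.aeval_right_pos (sq_nonneg c)
      have hP₁pos : 0 < aeval (c ^ 2) P₁ := by
        rw [hP₁r]
        refine mul_pos (Rat.cast_pos.2 hlP₁) (prod_pos fun i hi => ?_)
        linarith [hr0 i (mem_range.1 hi), sq_nonneg c]
      have hP : aeval (c ^ 2) P = d * c ^ 2 * aeval (c ^ 2) Q + aeval (c ^ 2) P₁ := by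
        rw [hP₁x]; ring
      have hQ : aeval (c ^ 2) Q = e * aeval (c ^ 2) P₁ + aeval (c ^ 2) Q₁ := by
        rw [hQ₁x]; ring
      have hin : (e : ℝ) * c + 1 / contFrac c (a :: l) =
          c * aeval (c ^ 2) Q / aeval (c ^ 2) P₁ := by
        rw [hlc, hQ]
        field_simp
      rw [contFrac, contFrac, hin, hP]
      field_simp

theorem exists_decreasing_enumeration (s : Finset ℝ) : ∃ r : ℕ → ℝ,
    (∀ i, i + 1 < #s → r (i + 1) < r i) ∧ (∀ i < #s, r i ∈ s) ∧ ∀ x ∈ s, ∃ i < #s, r i = x := by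
  let g := s.orderEmbOfFin rfl
  refine ⟨fun i => if h : i < #s then g (Fin.rev ⟨i, h⟩) else 0, ?_, ?_, ?_⟩
  · intro i hi
    simp only [hi, (Nat.lt_succ_self i).trans hi, dif_pos]
    exact g.strictMono (Fin.rev_lt_rev.2 (by simp [Fin.lt_def]))
  · intro i hi
    simp only [hi, dif_pos]
    exact s.orderEmbOfFin_mem rfl _
  · intro x hx
    obtain ⟨j, rfl⟩ : x ∈ Set.range g := by rw [s.range_orderEmbOfFin rfl]; exact hx
    refine ⟨(Fin.rev j : Fin _), (Fin.rev j).2, ?_⟩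
    simp only [(Fin.rev j).2, dif_pos, Fin.eta, Fin.rev_rev]

/-- If all roots of the minimal polynomial of `w` other than `w` are negative reals, then the
number of its real roots is its degree. -/
theorem card_aroots_minpoly {w : ℝ} (hw : IsIntegral ℚ w)
    (hreal : ∀ z : ℂ, aeval z (minpoly ℚ w) = 0 → z ≠ (w : ℂ) → ∃ r : ℝ, r < 0 ∧ z = (r : ℂ)) :
    #((minpoly ℚ w).aroots ℝ).toFinset = (minpoly ℚ w).natDegree := by
  have hp := minpoly.ne_zero hw
  have himage : (((minpoly ℚ w).aroots ℝ).toFinset.image (fun r : ℝ => (r : ℂ))) =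
      ((minpoly ℚ w).aroots ℂ).toFinset := by
    ext z
    simp only [mem_image, Multiset.mem_toFinset, mem_aroots]
    constructor
    · rintro ⟨r, ⟨-, hr⟩, rfl⟩
      refine ⟨hp, ?_⟩
      rw [← Complex.coe_algebraMap, aeval_algebraMap_apply, hr, map_zero]
    · rintro ⟨-, hz⟩
      obtain ⟨r, rfl⟩ : ∃ r : ℝ, z = (r : ℂ) := by
        by_cases hzw : z = w
        · exact ⟨w, hzw⟩
        · obtain ⟨r, -, hr⟩ := hreal z hz hzw
          exact ⟨r, hr⟩
      refine ⟨r, ⟨hp, ?_⟩, rfl⟩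
      rw [← Complex.coe_algebraMap, aeval_algebraMap_apply] at hz
      exact (map_eq_zero _).1 hz
  rw [← card_image_of_injective _ Complex.ofReal_injective, himage,
    Multiset.toFinset_card_of_nodup (nodup_roots (minpoly.irreducible hw).separable.map)]
  exact (IsAlgClosed.card_aroots_eq_natDegree)

/-- With `p` the minimal polynomial of `c ^ 2`, choose rationals strictly between consecutive roots
of `p` and let `Q` be a large multiple of the polynomial with these roots. Then `p + Q` and `Q`
interlace, and `(p + Q) / Q = 1` at `c ^ 2`. -/
theorem exists_contFrac_of_conjugates_neg {c : ℝ} (hc : 0 < c) (hint : IsIntegral ℚ (c ^ 2))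
    (hreal : ∀ z : ℂ, aeval z (minpoly ℚ (c ^ 2)) = 0 → z ≠ ((c ^ 2 : ℝ) : ℂ) →
      ∃ r : ℝ, r < 0 ∧ z = (r : ℂ)) :
    ∃ d : List ℚ, d ≠ [] ∧ (∀ q ∈ d, 0 < q) ∧ 1 / contFrac c d = c := by
  set w := c ^ 2
  have hw : 0 < w := pow_pos hc 2
  set p := minpoly ℚ w
  have hmonic : p.Monic := minpoly.monic hint
  have hcard : #(p.aroots ℝ).toFinset = p.natDegree := card_aroots_minpoly hint hreal
  obtain ⟨r, hrch, hrmem, hrsurj⟩ := exists_decreasing_enumeration (p.aroots ℝ).toFinset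
  obtain ⟨m, hm⟩ : ∃ m, p.natDegree = m + 1 :=
    Nat.exists_eq_succ_of_ne_zero (minpoly.natDegree_pos hint).ne'
  rw [hcard, hm] at hrch hrmem hrsurj
  have hroot : ∀ i < m + 1, aeval (r i) p = 0 := fun i hi =>
    (mem_aroots.1 (Multiset.mem_toFinset.1 (hrmem i hi))).2
  have hneg : ∀ i < m + 1, r i ≠ w → r i < 0 := fun i hi hne => by
    obtain ⟨s, hs, hrs⟩ := hreal (r i)
      (by rw [← Complex.coe_algebraMap, aeval_algebraMap_apply, hroot i hi, map_zero])
      (fun h => hne (Complex.ofReal_injective h))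
    rwa [Complex.ofReal_injective hrs]
  have hr0 : r 0 = w := by
    obtain ⟨j, hj, hjw⟩ := hrsurj w (Multiset.mem_toFinset.2
      (mem_aroots.2 ⟨hmonic.ne_zero, minpoly.aeval ℚ w⟩))
    by_contra hne
    have hj0 : 0 < j := Nat.pos_of_ne_zero fun h => hne (h ▸ hjw)
    linarith [hneg 0 (by omega) hne, lt_of_lt_of_chain hrch hj0 hj]
  have hrneg : ∀ i, i + 1 < m + 1 → r (i + 1) < 0 := fun i hi =>
    hneg (i + 1) hi (hr0 ▸ (lt_of_lt_of_chain hrch (Nat.succ_pos i) hi).ne)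
  have hpx := aeval_eq_of_map_eq (map_eq_C_mul_prod hm.le hrch hroot)
  rw [hmonic.leadingCoeff, Rat.cast_one] at hpx
  have hq : ∀ k, ∃ q : ℚ, k < m → r (k + 1) < q ∧ (q : ℝ) < r k ∧ q < 0 := by
    intro k
    by_cases hk : k < m
    · obtain ⟨q, hq1, hq2⟩ := exists_rat_btwn
        (lt_min (hrch k (by omega)) (hrneg k (by omega)))
      exact ⟨q, fun _ => ⟨hq1, (lt_min_iff.1 hq2).1, by exact_mod_cast (lt_min_iff.1 hq2).2⟩⟩
    · exact ⟨0, fun h => absurd h hk⟩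
  choose q hq using hq
  set G : ℚ[X] := ∏ k ∈ range m, (X - C (q k))
  have hG : G.Monic := monic_prod_X_sub_C _ _
  have hGdeg : G.natDegree = m := by
    rw [natDegree_finsetProd_X_sub_C_eq_card, card_range]
  have hGx : ∀ x : ℝ, aeval x G = ∏ k ∈ range m, (x - q k) := fun x => by
    simp [G]
  have hG0 : 0 < G.eval 0 := by
    simp only [G, eval_prod, eval_sub, eval_X, eval_C]
    exact prod_pos fun k hk => by linarith [(hq k (mem_range.1 hk)).2.2]
  -- The factor is chosen so that `p + Q` is positive at `0`.
  set K : ℚ := 1 + |p.eval 0| / G.eval 0 with hK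
  have hK0 : 0 < K := by positivity
  set Q : ℚ[X] := C K * G with hQ
  have hQdeg : Q.natDegree = m := by rw [hQ, natDegree_C_mul hK0.ne', hGdeg]
  have hQlc : Q.leadingCoeff = K := by rw [hQ, leadingCoeff_mul, hG, leadingCoeff_C, mul_one]
  have hQq : ∀ k < m, aeval (q k : ℝ) Q = 0 := fun k hk => by
    rw [hQ, map_mul, hGx, prod_eq_zero (mem_range.2 hk) (sub_self _), mul_zero]
  have hdeg : Q.degree < p.degree := degree_lt_degree (by omega)
  have hP : (p + Q).Monic := hmonic.add_of_left hdeg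
  have hpair : IsStieltjesPair (p + Q) Q m (fun k => q k) :=
    { natDegree_left := by rw [natDegree_add_eq_left_of_degree_lt hdeg, hm]
      leadingCoeff_left := by rw [hP.leadingCoeff]; exact one_pos
      natDegree_right := hQdeg
      leadingCoeff_right := by rwa [hQlc]
      aeval_right := fun x => by rw [hQlc, hQ, map_mul, hGx, aeval_C]; rfl
      chain := fun i hi => (hq (i + 1) hi).2.1.trans (hq i (by omega)).1
      neg := fun i hi => by exact_mod_cast (hq i hi).2.2
      aeval_zero := by
        have h0 : 0 < (p + Q).eval 0 := by
          rw [hQ, eval_add, eval_mul, eval_C, hK, add_mul, div_mul_cancel₀ _ hG0.ne']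
          linarith [neg_abs_le (p.eval 0)]
        rw [aeval_def, eval₂_at_zero, coeff_zero_eq_eval_zero]
        exact Rat.cast_pos.2 h0
      sign := fun k hk => by
        rw [map_add, hQq k hk, add_zero, hpx, one_mul]
        refine sign_prod_sub (by omega) (fun i hi => ?_) fun i hi hki => ?_
        · rcases eq_or_lt_of_le (Nat.le_of_lt_succ hi) with rfl | hlt
          · exact (hq i hk).2.1
          · exact (hq k hk).2.1.trans (lt_of_lt_of_chain hrch hlt (by omega))
        · rcases eq_or_lt_of_le hki with rfl | hlt
          · exact (hq k hk).1
          · exact (lt_of_lt_of_chain hrch hlt hi).trans (hq k hk).1 }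
  obtain ⟨d, hd, hpos, hval⟩ := hpair.exists_contFrac hc
  refine ⟨d, hd, hpos, ?_⟩
  have hQw := hpair.aeval_right_pos hw.le
  have hval' : contFrac c d = 1 / c := by
    rw [hval, map_add, minpoly.aeval, zero_add, div_mul_cancel_right₀ hQw.ne', one_div]
  rw [hval', one_div_one_div]

end Stieltjes

theorem theorem4 (c : ℝ) (hc : 0 < c) :
    [(∃ (R : Rect) (T : Finset Rect), R.ratio = c ∧ IsTiling T R ∧
        (∀ A ∈ T, A.ratio = c ∨ A.ratio = 1 / c) ∧ (∃ A ∈ T, A.ratio = 1 / c)),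
      (IsAlgebraic ℚ (c ^ 2) ∧
        ∀ z : ℂ, Polynomial.aeval z (minpoly ℚ (c ^ 2)) = 0 → z ≠ ((c ^ 2 : ℝ) : ℂ) →
          ∃ r : ℝ, r < 0 ∧ z = (r : ℂ)),
      (∃ d : List ℚ, d ≠ [] ∧ (∀ q ∈ d, 0 < q) ∧ 1 / contFrac c d = c)].TFAE := by
  tfae_have 1 → 2 := by
    rintro ⟨R, T, hR, hT, hr, hA⟩
    have h : IsMixedTiling c T R := ⟨hT, hR, hr, hA⟩
    exact ⟨h.isAlgebraic hc, fun z hz hne => h.neg_of_aeval_minpoly hc hz hne⟩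
  tfae_have 2 → 3 := fun ⟨halg, hreal⟩ =>
    exists_contFrac_of_conjugates_neg hc halg.isIntegral hreal
  tfae_have 3 → 1 := fun ⟨_, hd, hpos, h⟩ => exists_tiling_of_contFrac hc hd hpos h
  tfae_finish
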